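/- Let $\mathbb F_q$ be a finite field with $q$ elements and let $n$ be a positive integer with $\gcd(n,q)=1$. Let $\operatorname{rad}(n)$ be the product of the distinct primes dividing $n$, and let $w$ be the multiplicative order of $q$ modulo $\operatorname{rad}(n)$. Put $s=w$ if $4\nmid n$ or $q^w\equiv 1\pmod 4$, and $s=2w$ otherwise. For every positive integer $t$ put $d^{(t)}=\gcd(n,q^t-1)$. Let $\zeta$ be a primitive $d^{(s)}$-th root of unity in an extension field of $\mathbb F_q$, and let $I$ be a complete set of non-negative integers representing the $q$-cyclotomic cosets $\{i q^j \bmod d^{(s)} : j\ge 0\}$ modulo $d^{(s)}$ (every coset is the coset of exactly one element of $I$). For $i\in I$ let $$c_i=\min\Bigl\{t\in\mathbb Z_{>0} : \tfrac{d^{(s)}}{d^{(t)}}\ \text{divides}\ i\Bigr\},$$ where a rational number $r$ is said to divide $i$ if $i$ is an integral multiple of $r$. Then the factorization of $X^n-1$ into monic irreducible polynomials over $\mathbb F_q$ is $$X^n-1=\prod_{v\mid n/d^{(s)}}\ \prod_{\substack{i\in I\\ \gcd(i,v)=1}} S_{v,i},$$ $$S_{v,i}=\sum_{l=0}^{c_i}X^{vl}(-1)^{c_i-l}\sum_{\substack{U\subseteq\{0,\dots,c_i-1\}\\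 |U|=c_i-l}}\ \prod_{u\in U}\zeta^{iq^u}=\prod_{u=0}^{c_i-1}\bigl(X^v-\zeta^{iq^u}\bigr).$$ That is, for all such $v$ and $i$, the polynomial $S_{v,i}$ has its coefficients in $\mathbb F_q$ and is monic and irreducible over $\mathbb F_q$. It has degree $v\,c_i$, and its order (the least positive integer $e$ with $S_{v,i}\mid X^e-1$) is $v\cdot d^{(s)}/\gcd(i,d^{(s)})$. -/

import Mathlib

open Polynomial

/-- The multiplicative order `w` of `q` modulo the radical of `n`. -/
noncomputable def ordRad (q n : ℕ) : ℕ :=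
  orderOf (q : ZMod (UniqueFactorizationMonoid.radical n))

/-- `s = w` if `4 ∤ n` or `q ^ w ≡ 1 (mod 4)`, and `s = 2 w` otherwise. -/
noncomputable def extDeg (q n : ℕ) : ℕ :=
  if ¬ 4 ∣ n ∨ q ^ ordRad q n ≡ 1 [MOD 4] then ordRad q n else 2 * ordRad q n

/-- `d^{(t)} = gcd(n, q^t - 1)`. -/
def dGcd (q n t : ℕ) : ℕ := Nat.gcd n (q ^ t - 1)

/-- `c_i`, the least positive integer `t` such that `d^{(s)} / d^{(t)}` divides `i`.
The quotient is taken in `ℚ` (it need not be an integer for every `t`), and divisibility means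
that `i` is an integral multiple of it. -/
noncomputable def coeffDeg (q n i : ℕ) : ℕ :=
  sInf {t : ℕ | 0 < t ∧
    ∃ k : ℕ, (i : ℚ) = (dGcd q n (extDeg q n) : ℚ) / (dGcd q n t : ℚ) * k}

/-- The `q`-cyclotomic coset `{i q^j mod d : j ≥ 0}` of `i` modulo `d`. -/
def cyclotomicCoset (q d i : ℕ) : Set ℕ := {m | ∃ j : ℕ, m = i * q ^ j % d}

/-- `I` is a complete set of representatives of the `q`-cyclotomic cosets modulo `d`:
every coset is the coset of exactly one element of `I`. -/
def IsCosetRepSystem (q d : ℕ) (I : Finset ℕ) : Prop :=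
  ∀ a : ℕ, ∃! i : ℕ, i ∈ I ∧ cyclotomicCoset q d i = cyclotomicCoset q d a

/-- The order of a polynomial `f`: the least positive integer `e` with `f ∣ X^e - 1`. -/
noncomputable def polyOrder {F : Type*} [Field F] (f : F[X]) : ℕ :=
  sInf {e : ℕ | 0 < e ∧ f ∣ X ^ e - 1}

/-- The closed formula
`∑_{l=0}^{c} X^{v l} (-1)^{c-l} ∑_{U ⊆ {0,…,c-1}, |U| = c-l} ∏_{u ∈ U} ζ^{i q^u}`. -/
noncomputable def closedFactor {K : Type*} [Field K] (q : ℕ) (ζ : K) (c v i : ℕ) : K[X] :=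
  ∑ l ∈ Finset.range (c + 1), X ^ (v * l) * ((-1) ^ (c - l) *
    C (∑ U ∈ (Finset.range c).powersetCard (c - l), ∏ u ∈ U, ζ ^ (i * q ^ u)))

/-! Write `d` for `d^(s)`. The factor `S_{v,i}` is `f(X^v)`, with `f` the minimal polynomial of
`ζ^i`, of degree `c = c_i`. Let `a^v = ζ^i` and `e = ord(ζ^i) = d / gcd(i, d)`. Every prime of `v`
divides `e`, so `ord a = v e` (`orderOf_root`). The degree of `a` over `F` is then `c k` for some
`k` with `v e ∣ (q^c)^k - 1`. Lifting the exponent turns this into `v ∣ k`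
(`dvd_of_mul_dvd_pow_sub_one`), so `f(X^v)` is the minimal polynomial of `a`; the choice of `s` is
what makes the prime 2 behave. For the product, the order of a root determines `v`, and conjugacy
then determines the coset of `i`, so distinct factors are coprime. Conversely, an `n`-th root of
unity of order `m` is a root of a factor with `v = m / gcd(m, d)`. -/

section FiniteFieldExtension

/-! ### Minimal polynomials over a finite field -/

variable {F L : Type*} [Field F] [Field L] [Algebra F L]

theorem isIntegral_of_pow_eq_one {a : L} {m : ℕ} (hm : 0 < m) (ha : a ^ m = 1) :
    IsIntegral F a :=
  IsIntegral.of_pow hm (ha ▸ isIntegral_one)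

theorem polyOrder_minpoly {a : L} (ha : IsOfFinOrder a) : polyOrder (minpoly F a) = orderOf a := by
  have h (e : ℕ) : minpoly F a ∣ X ^ e - 1 ↔ orderOf a ∣ e := by
    rw [minpoly.dvd_iff, orderOf_dvd_iff_pow_eq_one]
    simp [sub_eq_zero]
  refine le_antisymm (Nat.sInf_le ⟨ha.orderOf_pos, (h _).2 dvd_rfl⟩)
    (le_csInf ⟨_, ha.orderOf_pos, (h _).2 dvd_rfl⟩ ?_)
  rintro e ⟨he, hdvd⟩
  exact Nat.le_of_dvd he ((h e).1 hdvd)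

theorem expand_minpoly_eq_minpoly {a b : L} {v : ℕ} (hv : 0 < v) (hb : IsIntegral F b)
    (hab : a ^ v = b) (hdeg : v * (minpoly F b).natDegree ∣ (minpoly F a).natDegree) :
    expand F v (minpoly F b) = minpoly F a := by
  have ha : IsIntegral F a := IsIntegral.of_pow hv (hab ▸ hb)
  refine eq_of_monic_of_dvd_of_natDegree_le (minpoly.monic ha) ((minpoly.monic hb).expand hv) ?_ ?_
  · apply minpoly.dvd
    rw [expand_aeval, hab, minpoly.aeval]
  · rw [natDegree_expand, mul_comm]
    exact Nat.le_of_dvd (minpoly.natDegree_pos ha) hdeg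

variable [Fintype F]

-- The degree of `a` is the order of Frobenius on `F(a)`, and a power of Frobenius is trivial there
-- as soon as it fixes `a`.
open IntermediateField in
theorem natDegree_minpoly_dvd_iff_pow_card_pow_eq {a : L} (ha : IsIntegral F a) (c : ℕ) :
    (minpoly F a).natDegree ∣ c ↔ a ^ Fintype.card F ^ c = a := by
  have : FiniteDimensional F F⟮a⟯ := adjoin.finiteDimensional ha
  have : Finite F⟮a⟯ := Module.finite_of_finite F
  have hpow (x : F⟮a⟯) :
      (FiniteField.frobeniusAlgHom F F⟮a⟯ ^ c) x = x ^ Fintype.card F ^ c := by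
    rw [AlgHom.coe_pow, FiniteField.coe_frobeniusAlgHom, pow_iterate]
  rw [← adjoin.finrank ha, ← FiniteField.orderOf_frobeniusAlgHom F F⟮a⟯,
    orderOf_dvd_iff_pow_eq_one]
  constructor
  · intro h
    have := hpow (AdjoinSimple.gen F a)
    rw [h, AlgHom.one_apply] at this
    simpa using (congrArg (algebraMap F⟮a⟯ L) this).symm
  · intro h
    refine adjoin_algHom_ext F fun x hx ↦ ?_
    obtain rfl : x = a := hx
    refine (hpow _).trans (Subtype.ext ?_)
    simpa using h

theorem natDegree_minpoly_dvd_iff_orderOf_dvd {a : L} (ha : IsOfFinOrder a) (c : ℕ) :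
    (minpoly F a).natDegree ∣ c ↔ orderOf a ∣ Fintype.card F ^ c - 1 := by
  have ha0 : a ≠ 0 := by
    rintro rfl
    exact ha.isUnit.ne_zero rfl
  rw [natDegree_minpoly_dvd_iff_pow_card_pow_eq
    (isIntegral_of_pow_eq_one ha.orderOf_pos (pow_orderOf_eq_one a)), orderOf_dvd_iff_pow_eq_one]
  conv_lhs => rw [← Nat.sub_add_cancel (Nat.one_le_pow c _ (Fintype.card_pos (α := F))), pow_succ]
  exact mul_eq_right₀ ha0

theorem aeval_pow_card_pow (P : F[X]) (a : L) (u : ℕ) :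
    aeval (a ^ Fintype.card F ^ u) P = aeval a P ^ Fintype.card F ^ u := by
  have hpow (x : L) : (FiniteField.frobeniusAlgHom F L ^ u) x = x ^ Fintype.card F ^ u := by
    rw [AlgHom.coe_pow, FiniteField.coe_frobeniusAlgHom, pow_iterate]
  rw [← hpow, ← hpow, aeval_algHom_apply]

theorem map_minpoly_eq_prod_X_sub_C {a : L} (ha : IsIntegral F a) :
    (minpoly F a).map (algebraMap F L) =
      ∏ u ∈ Finset.range (minpoly F a).natDegree, (X - C (a ^ Fintype.card F ^ u)) := by
  have hinj : ∀ u v, u < v → v < (minpoly F a).natDegree →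
      a ^ Fintype.card F ^ u ≠ a ^ Fintype.card F ^ v := by
    intro u v huv hv h
    have hfrob : Function.Injective (FiniteField.frobeniusAlgHom F L ^ u) :=
      (FiniteField.frobeniusAlgHom F L ^ u).toRingHom.injective
    have hpow (x : L) : (FiniteField.frobeniusAlgHom F L ^ u) x = x ^ Fintype.card F ^ u := by
      rw [AlgHom.coe_pow, FiniteField.coe_frobeniusAlgHom, pow_iterate]
    -- Cancelling `u` Frobenius steps leaves `a` fixed by a positive power below the degree, which
    -- is impossible.
    have h1 : a ^ Fintype.card F ^ (v - u) = a := by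
      apply hfrob
      rw [hpow, hpow, ← pow_mul, ← pow_add, Nat.sub_add_cancel huv.le, h]
    have := Nat.le_of_dvd (by omega)
      ((natDegree_minpoly_dvd_iff_pow_card_pow_eq ha _).2 h1)
    omega
  refine eq_of_monic_of_dvd_of_natDegree_le (monic_prod_X_sub_C _ _)
    ((minpoly.monic ha).map _) ?_ ?_
  · refine Finset.prod_dvd_of_coprime ?_ ?_
    · intro u hu v hv huv
      refine isCoprime_X_sub_C_of_isUnit_sub (sub_ne_zero.2 ?_).isUnit
      rw [Finset.mem_coe, Finset.mem_range] at hu hv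
      rcases lt_or_gt_of_ne huv with h | h
      · exact hinj u v h hv
      · exact (hinj v u h hu).symm
    · intro u _
      rw [dvd_iff_isRoot, IsRoot, eval_map_algebraMap, aeval_pow_card_pow, minpoly.aeval,
        zero_pow (pow_ne_zero _ Fintype.card_ne_zero)]
  · rw [natDegree_map, natDegree_prod_of_monic _ _ fun u _ ↦ monic_X_sub_C _]
    simp only [natDegree_X_sub_C, Finset.sum_const, Finset.card_range, smul_eq_mul, mul_one,
      le_refl]

end FiniteFieldExtension

/-! ### Expansion of the closed formula -/

theorem closedFactor_eq_prod {K : Type*} [Field K] (q : ℕ) (ζ : K) (c v i : ℕ) :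
    closedFactor q ζ c v i = ∏ u ∈ Finset.range c, (X ^ v - C (ζ ^ (i * q ^ u))) := by
  rw [Finset.prod_sub, Finset.sum_powerset, Finset.card_range, ← Finset.sum_range_reflect,
    closedFactor]
  refine Finset.sum_congr rfl fun l hl ↦ ?_
  have hl : l ≤ c := Nat.lt_succ_iff.1 (Finset.mem_range.1 hl)
  rw [show c + 1 - 1 - l = c - l by omega, map_sum, Finset.mul_sum, Finset.mul_sum]
  refine Finset.sum_congr rfl fun U hU ↦ ?_
  obtain ⟨hU, hcard⟩ := Finset.mem_powersetCard.1 hU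
  rw [hcard, Finset.prod_const, Finset.card_sdiff_of_subset hU, Finset.card_range, hcard,
    Nat.sub_sub_self hl, ← pow_mul, map_prod]
  ring

/-! ### Valuations of `Q^k - 1` and the exponent `s` -/

/-- Applied with `Q = q^c` and `e = ord(ζ^i)`. For odd `p ∣ v`, `v_p(Q^k - 1) = v_p(Q - 1) +
v_p(k)`, and the first term cancels against `v_p(e)`. For `p = 2` and even `k` there is an extra
`v_2(Q + 1) - 1`, which vanishes when `4 ∣ Q - 1`; if `4 ∤ v`, evenness of `k` already suffices. -/
theorem dvd_of_mul_dvd_pow_sub_one {Q v e k : ℕ} (hQ : 1 < Q) (hk : k ≠ 0) (hv : v ≠ 0)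
    (he : e ≠ 0) (hdvd : ∀ p, p.Prime → p ∣ v → p ∣ e ∧ padicValNat p (Q - 1) = padicValNat p e)
    (hfour : 4 ∣ v → 4 ∣ e) (h : v * e ∣ Q ^ k - 1) : v ∣ k := by
  have hQk : Q ^ k - 1 ≠ 0 := by
    have := Nat.one_lt_pow hk hQ
    omega
  rw [← Nat.factorization_le_iff_dvd hv hk, Finsupp.le_def]
  intro p
  by_cases hpv : p.Prime ∧ p ∣ v
  swap
  · rw [Nat.factorization_eq_zero_iff v p |>.2 (by tauto)]
    exact Nat.zero_le _
  obtain ⟨hp, hpv⟩ := hpv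
  have : Fact p.Prime := ⟨hp⟩
  obtain ⟨hpe, hval⟩ := hdvd p hp hpv
  have hle : padicValNat p v + padicValNat p e ≤ padicValNat p (Q ^ k - 1) := by
    rw [← padicValNat.mul hv he]
    exact (padicValNat_dvd_iff_le hQk).1 (pow_padicValNat_dvd.trans h)
  have he1 : 1 ≤ padicValNat p e := one_le_padicValNat_of_dvd he hpe
  have hv1 : 1 ≤ padicValNat p v := one_le_padicValNat_of_dvd hv hpv
  have hpQ : p ∣ Q - 1 := dvd_of_one_le_padicValNat (hval ▸ he1)
  have hpQ' : ¬ p ∣ Q := fun h' ↦ by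
    have := (Nat.dvd_sub_iff_right hQ.le h').1 hpQ
    exact hp.one_lt.ne' (Nat.dvd_one.1 this)
  rw [Nat.factorization_def _ hp, Nat.factorization_def _ hp]
  rcases hp.eq_two_or_odd' with rfl | hodd
  · have hQodd : Odd Q := Nat.not_even_iff_odd.1 fun h' ↦ hpQ' h'.two_dvd
    rcases Nat.even_or_odd k with hkev | hkodd
    · have hk1 : 1 ≤ padicValNat 2 k := one_le_padicValNat_of_dvd hk hkev.two_dvd
      by_cases h4 : 4 ∣ v
      · have h4Q : 4 ∣ Q - 1 := by
          have h1 := (padicValNat_dvd_iff_le (p := 2) (n := 2) he).1 (hfour h4)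
          exact (padicValNat_dvd_iff_le (p := 2) (n := 2) (by omega)).2 (hval ▸ h1)
        have hQ1 : padicValNat 2 (Q + 1) = 1 := by
          have h1 : 1 ≤ padicValNat 2 (Q + 1) := one_le_padicValNat_of_dvd (by omega) (by omega)
          have h2 : ¬ 2 ≤ padicValNat 2 (Q + 1) := fun h' ↦ by
            have := (padicValNat_dvd_iff_le (p := 2) (n := 2) (by omega)).2 h'
            omega
          omega
        have := padicValNat.pow_two_sub_pow hQ hpQ hpQ' hk hkev
        rw [one_pow] at this
        omega
      · have h2 : ¬ 2 ≤ padicValNat 2 v := fun h' ↦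
          h4 ((padicValNat_dvd_iff_le (p := 2) (n := 2) hv).2 h')
        omega
    -- For odd `k` the geometric sum has an odd number of odd terms, so `Q^k - 1` gains no factor 2
    -- over `Q - 1`, leaving no room for `2 ∣ v`.
    · exfalso
      have hgeom : (∑ j ∈ Finset.range k, Q ^ j) * (Q - 1) = Q ^ k - 1 :=
        Nat.geomSum_eq hQ k ▸ Nat.div_mul_cancel (by simpa using Nat.sub_dvd_pow_sub_pow Q 1 k)
      have hsum : Odd (∑ j ∈ Finset.range k, Q ^ j) := by
        rw [Finset.odd_sum_iff_odd_card_odd]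
        rw [Finset.filter_true_of_mem fun j _ ↦ hQodd.pow]
        simpa using hkodd
      rw [← hgeom, padicValNat.mul (fun h' ↦ by simp [h'] at hsum) (by omega),
        padicValNat.eq_zero_of_not_dvd hsum.not_two_dvd_nat, hval] at hle
      omega
  · have := padicValNat.pow_sub_pow hodd hQ hpQ hpQ' hk
    rw [one_pow] at this
    omega

theorem prime_dvd_pow_extDeg_sub_one {q n p : ℕ} (hq : 0 < q) (hn : n ≠ 0) (hp : p.Prime)
    (hpn : p ∣ n) : p ∣ q ^ extDeg q n - 1 := by
  have hw : p ∣ q ^ ordRad q n - 1 := by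
    have hrad : p ∣ UniqueFactorizationMonoid.radical n :=
      (UniqueFactorizationMonoid.dvd_radical_iff_of_irreducible hp hn).2 hpn
    refine hrad.trans ((Nat.modEq_iff_dvd' (Nat.one_le_pow _ _ hq)).1 ?_)
    rw [← ZMod.natCast_eq_natCast_iff, Nat.cast_pow, Nat.cast_one, ordRad, pow_orderOf_eq_one]
  unfold extDeg
  split_ifs
  · exact hw
  · exact hw.trans (Nat.pow_sub_one_dvd_pow_sub_one q (dvd_mul_left _ _))

theorem four_dvd_pow_extDeg_sub_one {q n : ℕ} (hnq : Nat.gcd n q = 1) (h : 4 ∣ n) :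
    4 ∣ q ^ extDeg q n - 1 := by
  have hodd : Odd q := by
    rw [← Nat.not_even_iff_odd, even_iff_two_dvd]
    intro h2
    have := Nat.dvd_gcd (Dvd.dvd.trans (by norm_num : 2 ∣ 4) h) h2
    omega
  unfold extDeg
  split_ifs with hc
  · have := hc.resolve_left (not_not.2 h)
    exact (Nat.modEq_iff_dvd' (Nat.one_le_pow _ _ hodd.pos)).1 this.symm
  · rw [mul_comm, pow_mul]
    have := Nat.eight_dvd_sq_sub_one_of_odd (hodd.pow (n := ordRad q n))
    omega

/-- The valuation of the gcd is a minimum that `n` strictly exceeds, so it is attained at `N`. -/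
theorem padicValNat_gcd_of_dvd_div_gcd {n N p : ℕ} (hn : n ≠ 0) (hp : p.Prime)
    (h : p ∣ n / Nat.gcd n N) : N ≠ 0 ∧ padicValNat p (Nat.gcd n N) = padicValNat p N := by
  have : Fact p.Prime := ⟨hp⟩
  have hN : N ≠ 0 := by
    rintro rfl
    rw [Nat.gcd_zero_right, Nat.div_self (Nat.pos_of_ne_zero hn)] at h
    exact hp.one_lt.ne' (Nat.dvd_one.1 h)
  refine ⟨hN, ?_⟩
  have hg : Nat.gcd n N ∣ n := Nat.gcd_dvd_left n N
  have hne : n / Nat.gcd n N ≠ 0 := (Nat.div_pos (Nat.le_of_dvd (by omega) hg)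
    (Nat.gcd_pos_of_pos_left _ (by omega))).ne'
  have h1 := one_le_padicValNat_of_dvd hne h
  rw [padicValNat.div_of_dvd hg] at h1
  rw [← Nat.factorization_def _ hp, Nat.factorization_gcd hn hN, Finsupp.inf_apply,
    Nat.factorization_def _ hp, Nat.factorization_def _ hp]
  rw [← Nat.factorization_def _ hp, ← Nat.factorization_def _ hp, Nat.factorization_gcd hn hN,
    Finsupp.inf_apply, Nat.factorization_def _ hp, Nat.factorization_def _ hp] at h1
  omega

/-! ### Orders of the roots -/

theorem orderOf_eq_mul_of_orderOf_pow {G : Type*} [Monoid G] {a : G} {v e : ℕ} (hv : v ≠ 0)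
    (ha : orderOf (a ^ v) = e) (h : ∀ p, p.Prime → p ∣ v → p ∣ e) :
    orderOf a = v * e := by
  have ho : orderOf a = e * Nat.gcd (orderOf a) v := by
    rw [← ha, orderOf_pow' a hv, Nat.div_mul_cancel (Nat.gcd_dvd_left _ _)]
  obtain ⟨t, ht⟩ := Nat.gcd_dvd_right (orderOf a) v
  set g := Nat.gcd (orderOf a) v with hg
  have hg0 : 0 < g := Nat.gcd_pos_of_pos_right _ (Nat.pos_of_ne_zero hv)
  -- Here `orderOf a = e g` and `v = g t` have gcd `g`. A prime of `t` would divide `v`, hence `e`,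
  -- so `t = 1`.
  have hcop : Nat.gcd e t = 1 := by
    have : g * Nat.gcd e t = g * 1 := by
      rw [← Nat.gcd_mul_left, mul_comm g e, ← ho, ← ht, mul_one]
    exact Nat.eq_of_mul_eq_mul_left hg0 this
  have ht1 : t = 1 := by
    by_contra hne
    obtain ⟨p, hp, hpt⟩ := Nat.exists_prime_and_dvd hne
    have := Nat.dvd_gcd (h p hp (ht ▸ hpt.mul_left g)) hpt
    rw [hcop] at this
    exact hp.one_lt.ne' (Nat.dvd_one.1 this)
  rw [ho, ht, ht1, mul_one, mul_comm]

theorem dGcd_pos {q n : ℕ} (hn : 0 < n) (t : ℕ) : 0 < dGcd q n t :=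
  Nat.gcd_pos_of_pos_left _ hn

theorem prime_dvd_dGcd_extDeg {q n p : ℕ} (hq : 0 < q) (hn : n ≠ 0) (hp : p.Prime)
    (hpn : p ∣ n) : p ∣ dGcd q n (extDeg q n) :=
  Nat.dvd_gcd hpn (prime_dvd_pow_extDeg_sub_one hq hn hp hpn)

theorem dvd_of_dvd_div_dGcd {q n v t : ℕ} (hv : v ∣ n / dGcd q n t) : v ∣ n :=
  hv.trans (Nat.div_dvd_of_dvd (Nat.gcd_dvd_left _ _))

theorem orderOf_pow_dGcd {L : Type*} [Field L] {q n : ℕ} (hn : 0 < n) {ζ : L} {t : ℕ}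
    (hζ : IsPrimitiveRoot ζ (dGcd q n t)) (i : ℕ) :
    orderOf (ζ ^ i) = dGcd q n t / Nat.gcd i (dGcd q n t) := by
  rw [(hζ.isOfFinOrder (dGcd_pos hn t).ne').orderOf_pow, ← hζ.eq_orderOf, Nat.gcd_comm]

theorem orderOf_root {L : Type*} [Field L] {q n : ℕ} (hq : 0 < q) (hn : 0 < n) {ζ a : L}
    (hζ : IsPrimitiveRoot ζ (dGcd q n (extDeg q n))) {v i : ℕ}
    (hv : v ∣ n / dGcd q n (extDeg q n)) (hiv : Nat.gcd i v = 1) (ha : a ^ v = ζ ^ i) :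
    orderOf a =
      v * (dGcd q n (extDeg q n) / Nat.gcd i (dGcd q n (extDeg q n))) := by
  have hvn := dvd_of_dvd_div_dGcd hv
  refine orderOf_eq_mul_of_orderOf_pow (ne_zero_of_dvd_ne_zero hn.ne' hvn)
    (by rw [ha, orderOf_pow_dGcd hn hζ]) fun p hp hpv ↦ ?_
  have hpd := prime_dvd_dGcd_extDeg hq hn.ne' hp (hpv.trans hvn)
  rw [← Nat.div_mul_cancel (Nat.gcd_dvd_right i (dGcd q n (extDeg q n)))] at hpd
  refine (hp.dvd_mul.1 hpd).resolve_right fun h ↦ ?_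
  have := Nat.dvd_gcd (h.trans (Nat.gcd_dvd_left _ _)) hpv
  rw [hiv] at this
  exact hp.one_lt.ne' (Nat.dvd_one.1 this)

/-- Recovers `e`, and hence `v`, from the order `v e` of a root. -/
theorem gcd_mul_div_gcd {d v i : ℕ} (hiv : Nat.gcd i v = 1) :
    Nat.gcd (v * (d / Nat.gcd i d)) d = d / Nat.gcd i d := by
  have hcop : Nat.gcd v (Nat.gcd i d) = 1 :=
    Nat.Coprime.coprime_dvd_right (Nat.gcd_dvd_left i d) (Nat.Coprime.symm hiv)
  conv_lhs => arg 2; rw [← Nat.mul_div_cancel' (Nat.gcd_dvd_right i d)]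
  rw [Nat.gcd_mul_right, hcop, one_mul]

/-! ### Cyclotomic cosets -/

theorem cyclotomicCoset_eq_of_modEq {q d i j u : ℕ} (hqd : Nat.Coprime q d) (hd : 0 < d)
    (h : i ≡ j * q ^ u [MOD d]) : cyclotomicCoset q d i = cyclotomicCoset q d j := by
  have key : ∀ {a b t : ℕ}, a ≡ b * q ^ t [MOD d] →
      cyclotomicCoset q d a ⊆ cyclotomicCoset q d b := by
    rintro a b t hab m ⟨k, rfl⟩
    refine ⟨t + k, ?_⟩
    rw [pow_add, ← mul_assoc]
    exact hab.mul_right _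
  -- By Euler's theorem this exponent makes a power of `q` inverse to `q^u` modulo `d`.
  refine (key h).antisymm (key (t := u * (d.totient - 1)) ?_)
  have h1 := h.mul_right (q ^ (u * (d.totient - 1)))
  have hpow : q ^ u * q ^ (u * (d.totient - 1)) = (q ^ d.totient) ^ u := by
    have := Nat.totient_pos.2 hd
    rw [← pow_add, ← pow_mul, mul_comm d.totient]
    congr 1
    obtain ⟨k, hk⟩ : ∃ k, d.totient = k + 1 := ⟨d.totient - 1, by omega⟩
    rw [hk, Nat.add_sub_cancel]
    ring
  have h2 := ((Nat.ModEq.pow_totient hqd).pow u).mul_left j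
  rw [mul_assoc, hpow] at h1
  rw [one_pow, mul_one] at h2
  exact (h1.trans h2).symm

theorem modEq_of_cyclotomicCoset_eq {q d i j : ℕ}
    (h : cyclotomicCoset q d i = cyclotomicCoset q d j) : ∃ u, j ≡ i * q ^ u [MOD d] := by
  have hj : j % d ∈ cyclotomicCoset q d i := h ▸ ⟨0, by simp⟩
  exact hj

/-! ### Irreducibility of the factors and the product formula -/

section

variable {F L : Type*} [Field F] [Fintype F] [Field L] [Algebra F L] {q n : ℕ}

/-- The condition on `t` reads `d ∣ i d^(t) = gcd(i n, i (q^t - 1))`. Since `d ∣ n`, only `d ∣ i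
(q^t - 1)` matters: Frobenius to the `t` fixes `ζ^i`. -/
theorem coeffDeg_eq_natDegree_minpoly (hq : Fintype.card F = q) (hn : 0 < n) {ζ : L}
    (hζ : IsPrimitiveRoot ζ (dGcd q n (extDeg q n))) (i : ℕ) :
    coeffDeg q n i = (minpoly F (ζ ^ i)).natDegree := by
  have hd := dGcd_pos (q := q) hn (extDeg q n)
  have hfin : IsOfFinOrder (ζ ^ i) := (hζ.isOfFinOrder hd.ne').pow
  have hpos : 0 < (minpoly F (ζ ^ i)).natDegree := minpoly.natDegree_pos
    (isIntegral_of_pow_eq_one hfin.orderOf_pos (pow_orderOf_eq_one _))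
  have hset (t : ℕ) : (∃ k : ℕ, (i : ℚ) =
      (dGcd q n (extDeg q n) : ℚ) / (dGcd q n t : ℚ) * k) ↔
      (minpoly F (ζ ^ i)).natDegree ∣ t := by
    have hdt : (dGcd q n t : ℚ) ≠ 0 := by exact_mod_cast (dGcd_pos hn t).ne'
    have h1 (k : ℕ) : (i : ℚ) = (dGcd q n (extDeg q n) : ℚ) / (dGcd q n t : ℚ) * k ↔
        i * dGcd q n t = dGcd q n (extDeg q n) * k := by
      rw [div_mul_eq_mul_div, eq_div_iff hdt]
      exact_mod_cast Iff.rfl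
    simp_rw [h1]
    rw [natDegree_minpoly_dvd_iff_orderOf_dvd hfin, hq, orderOf_dvd_iff_pow_eq_one, ← pow_mul,
      hζ.pow_eq_one_iff_dvd, ← dvd_def, dGcd, dGcd, ← Nat.gcd_mul_left, Nat.dvd_gcd_iff]
    exact and_iff_right ((Nat.gcd_dvd_left _ _).mul_left _)
  simp_rw [coeffDeg, hset]
  refine le_antisymm (Nat.sInf_le ⟨hpos, dvd_rfl⟩) (le_csInf ⟨_, hpos, dvd_rfl⟩ ?_)
  rintro t ⟨ht, hdvd⟩
  exact Nat.le_of_dvd ht hdvd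

theorem expand_minpoly_pow_eq_minpoly_root (hq : Fintype.card F = q) (hn : 0 < n)
    (hnq : Nat.gcd n q = 1) {ζ a : L} (hζ : IsPrimitiveRoot ζ (dGcd q n (extDeg q n))) {v i : ℕ}
    (hv : v ∣ n / dGcd q n (extDeg q n)) (hiv : Nat.gcd i v = 1) (ha : a ^ v = ζ ^ i) :
    expand F v (minpoly F (ζ ^ i)) = minpoly F a := by
  have hq1 : 1 < q := hq ▸ Fintype.one_lt_card
  have hvn := dvd_of_dvd_div_dGcd hv
  have hv0 : v ≠ 0 := ne_zero_of_dvd_ne_zero hn.ne' hvn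
  have hd := dGcd_pos (q := q) hn (extDeg q n)
  have hfin : IsOfFinOrder (ζ ^ i) := (hζ.isOfFinOrder hd.ne').pow
  have hint := isIntegral_of_pow_eq_one (F := F) hfin.orderOf_pos (pow_orderOf_eq_one _)
  have hafin : IsOfFinOrder a := (ha ▸ hfin).of_pow hv0
  have hord := orderOf_root (by omega) hn hζ hv hiv ha
  have he := orderOf_pow_dGcd hn hζ i
  have haint := isIntegral_of_pow_eq_one (F := F) hafin.orderOf_pos (pow_orderOf_eq_one _)
  refine expand_minpoly_eq_minpoly (Nat.pos_of_ne_zero hv0) hint ha ?_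
  set d := dGcd q n (extDeg q n) with hddef
  set c := (minpoly F (ζ ^ i)).natDegree with hc
  have hc0 : 0 < c := minpoly.natDegree_pos hint
  have hdvd := (natDegree_minpoly_dvd_iff_orderOf_dvd (F := F) hafin _).1 dvd_rfl
  have hec := (natDegree_minpoly_dvd_iff_orderOf_dvd (F := F) hfin _).1 dvd_rfl
  rw [hq] at hdvd hec
  rw [hord, ← he] at hdvd
  have hcr : c ∣ (minpoly F a).natDegree :=
    (natDegree_minpoly_dvd_iff_orderOf_dvd hfin _).2 (hq.symm ▸ (dvd_mul_left _ _).trans hdvd)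
  have hed : orderOf (ζ ^ i) ∣ d := he ▸ Nat.div_dvd_of_dvd (Nat.gcd_dvd_right i d)
  have hcs : c ∣ extDeg q n :=
    (natDegree_minpoly_dvd_iff_orderOf_dvd hfin _).2
      (hq.symm ▸ hed.trans (Nat.gcd_dvd_right _ _))
  obtain ⟨k, hk⟩ := hcr
  rw [hk, mul_comm v]
  refine mul_dvd_mul_left c ?_
  rw [hk, pow_mul] at hdvd
  -- As `p ∣ n / d`, `d` carries the full `p`-part of `q^s - 1`; as `p ∤ i`, so does `e`.
  have hval : ∀ p, p.Prime → p ∣ v → q ^ extDeg q n - 1 ≠ 0 ∧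
      padicValNat p (orderOf (ζ ^ i)) = padicValNat p (q ^ extDeg q n - 1) := by
    intro p hp hpv
    have : Fact p.Prime := ⟨hp⟩
    obtain ⟨hN, h1⟩ := padicValNat_gcd_of_dvd_div_gcd hn.ne' hp (hpv.trans hv)
    refine ⟨hN, ?_⟩
    have hpi : ¬ p ∣ Nat.gcd i d := fun h ↦ by
      have := Nat.dvd_gcd (h.trans (Nat.gcd_dvd_left _ _)) hpv
      rw [hiv] at this
      exact hp.one_lt.ne' (Nat.dvd_one.1 this)
    rw [he, padicValNat.div_of_dvd (Nat.gcd_dvd_right i d),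
      padicValNat.eq_zero_of_not_dvd hpi, Nat.sub_zero]
    exact h1
  refine dvd_of_mul_dvd_pow_sub_one (Nat.one_lt_pow hc0.ne' hq1) ?_ hv0 hfin.orderOf_pos.ne'
    (fun p hp hpv ↦ ?_) (fun h4 ↦ ?_) hdvd
  · rintro rfl
    exact (minpoly.natDegree_pos haint).ne' hk
  · have : Fact p.Prime := ⟨hp⟩
    obtain ⟨hN, h1⟩ := hval p hp hpv
    have hqc : q ^ c - 1 ≠ 0 := by
      have := Nat.one_lt_pow hc0.ne' hq1
      omega
    constructor
    · refine dvd_of_one_le_padicValNat (h1 ▸ one_le_padicValNat_of_dvd hN ?_)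
      exact prime_dvd_pow_extDeg_sub_one (by omega) hn.ne' hp (hpv.trans hvn)
    -- Squeeze from `e ∣ q^c - 1 ∣ q^s - 1`, whose outer terms have equal `p`-valuation.
    · apply le_antisymm
      · rw [h1]
        exact (padicValNat_dvd_iff_le hN).1
          (pow_padicValNat_dvd.trans (Nat.pow_sub_one_dvd_pow_sub_one q hcs))
      · exact (padicValNat_dvd_iff_le hqc).1 (pow_padicValNat_dvd.trans hec)
  · obtain ⟨hN, h1⟩ := hval 2 Nat.prime_two (Dvd.dvd.trans (by norm_num) h4)
    have := four_dvd_pow_extDeg_sub_one hnq (h4.trans hvn)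
    refine (padicValNat_dvd_iff_le (p := 2) (n := 2) hfin.orderOf_pos.ne').2 ?_
    rw [h1]
    exact (padicValNat_dvd_iff_le (p := 2) (n := 2) hN).1 this

theorem exists_pow_eq_of_aeval_eq_zero {b x : L} (hb : IsIntegral F b)
    (hx : aeval x (minpoly F b) = 0) : ∃ u, x = b ^ Fintype.card F ^ u := by
  rw [← eval_map_algebraMap, map_minpoly_eq_prod_X_sub_C hb, eval_prod,
    Finset.prod_eq_zero_iff] at hx
  obtain ⟨u, -, hu⟩ := hx
  exact ⟨u, by simpa [sub_eq_zero] using hu⟩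

/-- Computing the order of a common root from both sides gives `v = v'`; then `ζ^i` and `ζ^i'` are
conjugate. -/
theorem eq_of_expand_minpoly_pow_eq [IsAlgClosed L] (hq : Fintype.card F = q) (hn : 0 < n)
    (hnq : Nat.gcd n q = 1) {ζ : L} (hζ : IsPrimitiveRoot ζ (dGcd q n (extDeg q n)))
    {v v' i i' : ℕ} (hv : v ∣ n / dGcd q n (extDeg q n)) (hiv : Nat.gcd i v = 1)
    (hv' : v' ∣ n / dGcd q n (extDeg q n)) (hiv' : Nat.gcd i' v' = 1)
    (h : expand F v (minpoly F (ζ ^ i)) = expand F v' (minpoly F (ζ ^ i'))) :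
    v = v' ∧ cyclotomicCoset q (dGcd q n (extDeg q n)) i =
      cyclotomicCoset q (dGcd q n (extDeg q n)) i' := by
  have hq1 : 0 < q := hq ▸ Fintype.card_pos
  have hd := dGcd_pos (q := q) hn (extDeg q n)
  have hv0 : 0 < v := Nat.pos_of_dvd_of_pos (dvd_of_dvd_div_dGcd hv) hn
  obtain ⟨a, ha⟩ := IsAlgClosed.exists_pow_nat_eq (ζ ^ i) hv0
  have hroot : aeval (a ^ v') (minpoly F (ζ ^ i')) = 0 := by
    rw [← expand_aeval, ← h, expand_aeval, ha, minpoly.aeval]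
  have hfin : IsOfFinOrder (ζ ^ i') := (hζ.isOfFinOrder hd.ne').pow
  obtain ⟨u, hu⟩ := exists_pow_eq_of_aeval_eq_zero
    (isIntegral_of_pow_eq_one hfin.orderOf_pos (pow_orderOf_eq_one _)) hroot
  rw [← pow_mul, hq] at hu
  have hqv' : Nat.Coprime (q ^ u) v' := Nat.Coprime.pow_left u
    (Nat.Coprime.coprime_dvd_left (dvd_of_dvd_div_dGcd hv') hnq).symm
  have hiv'' : Nat.gcd (i' * q ^ u) v' = 1 := Nat.Coprime.mul_left hiv' hqv'
  have h1 := orderOf_root hq1 hn hζ hv hiv ha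
  have h2 := orderOf_root hq1 hn hζ hv' hiv'' hu
  have hvv : v = v' := by
    have h3 := gcd_mul_div_gcd (d := dGcd q n (extDeg q n)) hiv
    have h4 := gcd_mul_div_gcd (d := dGcd q n (extDeg q n)) hiv''
    rw [← h1] at h3
    rw [← h2] at h4
    rw [← h3] at h1
    rw [← h4] at h2
    exact Nat.eq_of_mul_eq_mul_right (Nat.gcd_pos_of_pos_right _ hd) (h1.symm.trans h2)
  refine ⟨hvv, ?_⟩
  rw [← hvv, ha, (hζ.isOfFinOrder hd.ne').pow_eq_pow_iff_modEq, ← hζ.eq_orderOf] at hu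
  refine cyclotomicCoset_eq_of_modEq ?_ hd hu
  exact (Nat.Coprime.coprime_dvd_left (Nat.gcd_dvd_left _ _) hnq).symm

theorem exists_aeval_expand_minpoly_pow_eq_zero (hq : Fintype.card F = q) (hn : 0 < n)
    {ζ : L} (hζ : IsPrimitiveRoot ζ (dGcd q n (extDeg q n)))
    {I : Finset ℕ} (hI : IsCosetRepSystem q (dGcd q n (extDeg q n)) I) {a : L} (ha : a ^ n = 1) :
    ∃ v, v ∣ n / dGcd q n (extDeg q n) ∧ ∃ i ∈ I, Nat.gcd i v = 1 ∧
      aeval a (expand F v (minpoly F (ζ ^ i))) = 0 := by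
  have hq1 : 0 < q := hq ▸ Fintype.card_pos
  have hd := dGcd_pos (q := q) hn (extDeg q n)
  have hdn : dGcd q n (extDeg q n) ∣ n := Nat.gcd_dvd_left _ _
  have hpd : ∀ p, p.Prime → p ∣ n → p ∣ dGcd q n (extDeg q n) :=
    fun p hp hpn ↦ prime_dvd_dGcd_extDeg hq1 hn.ne' hp hpn
  have hordpow := orderOf_pow_dGcd hn hζ
  set d := dGcd q n (extDeg q n)
  have hmn : orderOf a ∣ n := orderOf_dvd_of_pow_eq_one ha
  set m := orderOf a with hm
  have hm0 : 0 < m := Nat.pos_of_dvd_of_pos hmn hn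
  obtain ⟨v, hv⟩ := Nat.gcd_dvd_left m d
  set e := Nat.gcd m d with he
  have he0 : 0 < e := Nat.gcd_pos_of_pos_left _ hm0
  have hv0 : v ≠ 0 := by
    rintro rfl
    omega
  have hvdvd : v ∣ n / d := by
    rw [Nat.dvd_div_iff_mul_dvd hdn]
    refine Nat.dvd_of_mul_dvd_mul_left he0 ?_
    rw [mul_left_comm, ← hv, he, ← Nat.gcd_mul_right]
    exact Nat.dvd_gcd (mul_comm d m ▸ mul_dvd_mul_left m hdn)
      (mul_dvd_mul_left d hmn)
  have hvn : v ∣ n := hvdvd.trans (Nat.div_dvd_of_dvd hdn)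
  have hordv : orderOf (a ^ v) = e := by
    rw [orderOf_pow' a hv0, ← hm, hv, Nat.gcd_mul_left_left, Nat.mul_div_cancel _ (by omega)]
  have hone : (a ^ v) ^ d = 1 := orderOf_dvd_iff_pow_eq_one.1 (hordv ▸ Nat.gcd_dvd_right m d)
  have : NeZero d := ⟨hd.ne'⟩
  obtain ⟨j, -, hj⟩ := hζ.eq_pow_of_pow_eq_one hone
  have hej : e * Nat.gcd j d = d := by
    rw [← hordv, ← hj, hordpow, Nat.div_mul_cancel (Nat.gcd_dvd_right j d)]
  -- Since `m = e v` and `d = e gcd(j, d)` have gcd `e`, the cofactors are coprime.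
  have hcop : Nat.gcd v (Nat.gcd j d) = 1 := by
    have : e * Nat.gcd v (Nat.gcd j d) = e * 1 := by
      rw [← Nat.gcd_mul_left, ← hv, hej, mul_one]
    exact Nat.eq_of_mul_eq_mul_left he0 this
  obtain ⟨i, ⟨hiI, hi⟩, -⟩ := hI j
  obtain ⟨u, hu⟩ := modEq_of_cyclotomicCoset_eq hi
  -- Primes of `v` divide `d`, and modulo `d` the representative `i` differs from `j` by a power of
  -- `q`, so coprimality passes from `j` to `i`.
  refine ⟨v, hvdvd, i, hiI, Nat.Coprime.symm (Nat.coprime_of_dvd fun p hp hpv hpi ↦ ?_), ?_⟩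
  · have hpd := hpd p hp (hpv.trans hvn)
    have hpj : p ∣ j := (hu.dvd_iff hpd).2 (hpi.mul_right _)
    have := Nat.dvd_gcd hpv (Nat.dvd_gcd hpj hpd)
    rw [hcop] at this
    exact hp.one_lt.ne' (Nat.dvd_one.1 this)
  · have hji : ζ ^ j = (ζ ^ i) ^ Fintype.card F ^ u := by
      rw [← pow_mul, hq, (hζ.isOfFinOrder hd.ne').pow_eq_pow_iff_modEq, ← hζ.eq_orderOf]
      exact hu
    rw [expand_aeval, ← hj, hji, aeval_pow_card_pow, minpoly.aeval,
      zero_pow (pow_ne_zero _ Fintype.card_ne_zero)]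

theorem X_pow_sub_one_eq_prod_expand_minpoly [IsAlgClosed L] (hq : Fintype.card F = q)
    (hn : 0 < n) (hnq : Nat.gcd n q = 1) {ζ : L}
    (hζ : IsPrimitiveRoot ζ (dGcd q n (extDeg q n)))
    {I : Finset ℕ} (hI : IsCosetRepSystem q (dGcd q n (extDeg q n)) I) :
    (X ^ n - 1 : F[X]) = ∏ v ∈ (n / dGcd q n (extDeg q n)).divisors,
      ∏ i ∈ I with Nat.gcd i v = 1, expand F v (minpoly F (ζ ^ i)) := by
  have hq1 : 0 < q := hq ▸ Fintype.card_pos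
  have hd := dGcd_pos (q := q) hn (extDeg q n)
  have hdn : dGcd q n (extDeg q n) ∣ n := Nat.gcd_dvd_left _ _
  have hquot : n / dGcd q n (extDeg q n) ≠ 0 := (Nat.div_pos (Nat.le_of_dvd hn hdn) hd).ne'
  have hint (i : ℕ) : IsIntegral F (ζ ^ i) :=
    isIntegral_of_pow_eq_one (hζ.isOfFinOrder hd.ne').pow.orderOf_pos (pow_orderOf_eq_one _)
  have hfactor : ∀ v ∈ (n / dGcd q n (extDeg q n)).divisors, ∀ i, Nat.gcd i v = 1 →
      ∃ a : L, a ^ n = 1 ∧ expand F v (minpoly F (ζ ^ i)) = minpoly F a ∧ IsIntegral F a := by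
    intro v hv i hiv
    have hv := Nat.dvd_of_mem_divisors hv
    obtain ⟨a, ha⟩ := IsAlgClosed.exists_pow_nat_eq (ζ ^ i)
      (Nat.pos_of_dvd_of_pos (dvd_of_dvd_div_dGcd hv) hn)
    have han : a ^ n = 1 := by
      refine orderOf_dvd_iff_pow_eq_one.1 ?_
      rw [orderOf_root hq1 hn hζ hv hiv ha]
      have := mul_dvd_mul hv (Nat.div_dvd_of_dvd (Nat.gcd_dvd_right i (dGcd q n (extDeg q n))))
      rwa [Nat.div_mul_cancel hdn] at this
    exact ⟨a, han, expand_minpoly_pow_eq_minpoly_root hq hn hnq hζ hv hiv ha,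
      isIntegral_of_pow_eq_one hn han⟩
  rw [Finset.prod_sigma']
  set T := (n / dGcd q n (extDeg q n)).divisors.sigma fun v ↦ {i ∈ I | Nat.gcd i v = 1} with hT
  have hmemT {x : (_ : ℕ) × ℕ} (hx : x ∈ T) : x.1 ∈ (n / dGcd q n (extDeg q n)).divisors ∧
      x.2 ∈ I ∧ Nat.gcd x.2 x.1 = 1 := by
    simpa only [hT, Finset.mem_sigma, Finset.mem_filter] using hx
  have hmonic : (X ^ n - 1 : F[X]).Monic := monic_X_pow_sub_C 1 hn.ne'
  refine eq_of_monic_of_associated hmonic (monic_prod_of_monic _ _ fun x hx ↦ ?_)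
    (associated_of_dvd_dvd ?_ ?_)
  · exact (minpoly.monic (hint x.2)).expand (Nat.pos_of_mem_divisors (hmemT hx).1)
  -- With `n` invertible in `F`, `X^n - 1` has simple roots, so divisibility reduces to inclusion of
  -- root sets.
  · have hnF : (n : F) ≠ 0 := by
      intro h0
      have hp := CharP.cast_eq_zero_iff F (ringChar F) n |>.1 h0
      have hpq := CharP.cast_eq_zero_iff F (ringChar F) q |>.1
        (hq ▸ FiniteField.cast_card_eq_zero F)
      have := Nat.dvd_gcd hp hpq
      rw [hnq] at this
      exact CharP.ringChar_ne_one (Nat.dvd_one.1 this)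
    rw [← map_dvd_map' (algebraMap F L)]
    have hsep : ((X ^ n - 1 : F[X]).map (algebraMap F L)).Separable :=
      (X_pow_sub_one_separable_iff.2 hnF).map
    refine (IsAlgClosed.splits _).dvd_of_roots_le_roots (hmonic.map _).ne_zero ?_
    rw [Multiset.le_iff_subset (nodup_roots hsep)]
    intro a ha
    have han : a ^ n = 1 := by
      have := (mem_roots'.1 ha).2
      simpa [IsRoot, sub_eq_zero] using this
    obtain ⟨v, hv, i, hiI, hiv, hroot⟩ :=
      exists_aeval_expand_minpoly_pow_eq_zero hq hn hζ hI han
    refine (mem_roots (map_monic_ne_zero (monic_prod_of_monic _ _ fun x hx ↦ ?_))).2 ?_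
    · exact (minpoly.monic (hint x.2)).expand (Nat.pos_of_mem_divisors (hmemT hx).1)
    · rw [IsRoot, eval_map_algebraMap, map_prod]
      refine Finset.prod_eq_zero (i := ⟨v, i⟩) ?_ hroot
      simp [hT, hv, hquot, hiI, hiv]
  · refine Finset.prod_dvd_of_coprime ?_ ?_
    · intro x hx y hy hxy
      obtain ⟨hx1, hxI, hx2⟩ := hmemT hx
      obtain ⟨hy1, hyI, hy2⟩ := hmemT hy
      obtain ⟨a, -, ha, haint⟩ := hfactor x.1 hx1 x.2 hx2
      obtain ⟨b, -, hb, hbint⟩ := hfactor y.1 hy1 y.2 hy2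
      change IsCoprime (expand F x.1 _) (expand F y.1 _)
      rw [ha, hb, (minpoly.irreducible haint).coprime_iff_not_dvd]
      intro hdvd
      have heq : minpoly F a = minpoly F b :=
        eq_of_monic_of_associated (minpoly.monic haint) (minpoly.monic hbint)
          ((minpoly.irreducible haint).associated_of_dvd (minpoly.irreducible hbint) hdvd)
      obtain ⟨h1, h2⟩ := eq_of_expand_minpoly_pow_eq hq hn hnq hζ (Nat.dvd_of_mem_divisors hx1)
        hx2 (Nat.dvd_of_mem_divisors hy1) hy2 (ha.trans (heq.trans hb.symm))
      exact hxy (Sigma.ext h1 (heq_of_eq ((hI y.2).unique ⟨hxI, h2⟩ ⟨hyI, rfl⟩)))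
    · intro x hx
      obtain ⟨hx1, hxI, hx2⟩ := hmemT hx
      obtain ⟨a, han, ha, -⟩ := hfactor x.1 hx1 x.2 hx2
      rw [ha]
      apply minpoly.dvd
      simp [han]

end

theorem theorem2p5 {F K : Type*} [Field F] [Fintype F] [Field K] [Algebra F K]
    (q n : ℕ) (hq : Fintype.card F = q) (hn : 0 < n) (hnq : Nat.gcd n q = 1)
    (ζ : K) (hζ : IsPrimitiveRoot ζ (dGcd q n (extDeg q n)))
    (I : Finset ℕ) (hI : IsCosetRepSystem q (dGcd q n (extDeg q n)) I) :
    ∃ S : ℕ → ℕ → F[X],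
      ((X ^ n - 1 : F[X]) =
        ∏ v ∈ (n / dGcd q n (extDeg q n)).divisors,
          ∏ i ∈ I with Nat.gcd i v = 1, S v i) ∧
      ∀ v ∈ (n / dGcd q n (extDeg q n)).divisors, ∀ i ∈ I, Nat.gcd i v = 1 →
        (S v i).map (algebraMap F K) = closedFactor q ζ (coeffDeg q n i) v i ∧
        (S v i).map (algebraMap F K) =
          ∏ u ∈ Finset.range (coeffDeg q n i), (X ^ v - C (ζ ^ (i * q ^ u))) ∧
        (S v i).Monic ∧
        Irreducible (S v i) ∧
        (S v i).natDegree = v * coeffDeg q n i ∧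
        polyOrder (S v i) =
          v * (dGcd q n (extDeg q n) / Nat.gcd i (dGcd q n (extDeg q n))) := by
  have hd := dGcd_pos (q := q) hn (extDeg q n)
  have hq1 : 0 < q := hq ▸ Fintype.card_pos
  -- `K` may lack `v`-th roots of `ζ^i`; minimal polynomials over `F` do not change in the algebraic
  -- closure.
  have hξ : IsPrimitiveRoot (algebraMap K (AlgebraicClosure K) ζ) (dGcd q n (extDeg q n)) :=
    hζ.map_of_injective (algebraMap K (AlgebraicClosure K)).injective
  have hmin (i : ℕ) :
      minpoly F (algebraMap K (AlgebraicClosure K) ζ ^ i) = minpoly F (ζ ^ i) := by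
    rw [← map_pow, minpoly.algebraMap_eq (algebraMap K (AlgebraicClosure K)).injective]
  have hint (i : ℕ) : IsIntegral F (ζ ^ i) :=
    isIntegral_of_pow_eq_one (hζ.isOfFinOrder hd.ne').pow.orderOf_pos (pow_orderOf_eq_one _)
  have hprod := X_pow_sub_one_eq_prod_expand_minpoly hq hn hnq hξ hI
  simp_rw [hmin] at hprod
  refine ⟨fun v i ↦ expand F v (minpoly F (ζ ^ i)), hprod, fun v hv i hi hiv ↦ ?_⟩
  have hv := Nat.dvd_of_mem_divisors hv
  have hv0 : 0 < v := Nat.pos_of_dvd_of_pos (dvd_of_dvd_div_dGcd hv) hn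
  have hc := coeffDeg_eq_natDegree_minpoly hq hn hζ i
  obtain ⟨a, ha⟩ := IsAlgClosed.exists_pow_nat_eq (algebraMap K (AlgebraicClosure K) ζ ^ i) hv0
  have hroot := expand_minpoly_pow_eq_minpoly_root hq hn hnq hξ hv hiv ha
  rw [hmin] at hroot
  have hfin : IsOfFinOrder a :=
    (ha ▸ (hξ.isOfFinOrder hd.ne').pow : IsOfFinOrder (a ^ v)).of_pow hv0.ne'
  have haint := isIntegral_of_pow_eq_one (F := F) hfin.orderOf_pos (pow_orderOf_eq_one _)
  have hmap : (expand F v (minpoly F (ζ ^ i))).map (algebraMap F K) =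
      ∏ u ∈ Finset.range (coeffDeg q n i), (X ^ v - C (ζ ^ (i * q ^ u))) := by
    rw [map_expand, map_minpoly_eq_prod_X_sub_C (hint i), map_prod, hc, hq]
    simp only [map_sub, expand_X, expand_C, pow_mul]
  refine ⟨hmap.trans (closedFactor_eq_prod _ _ _ _ _).symm, hmap,
    (minpoly.monic (hint i)).expand hv0, ?_, ?_, ?_⟩
  · simpa only [hroot] using minpoly.irreducible haint
  · rw [natDegree_expand, hc, mul_comm]
  · simp only [hroot]
    rw [polyOrder_minpoly hfin, orderOf_root hq1 hn hξ hv hiv ha]
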